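/- Let $(\Omega,\mathcal A)$ be a countably generated measurable space, $\pi$ a probability measure on it, and $K$ a Markov kernel on $\Omega$ that is reversible with respect to $\pi$, i.e. $\int_B K(x,A)\,\pi(dx)=\int_A K(x,B)\,\pi(dx)$ for all $A,B\in\mathcal A$ (so that $\pi$ is stationary), and lazy, i.e. $K(x,\{x\})\ge \tfrac12$ for all $x\in\Omega$. Let $$\varphi=\varphi(K,\pi)=\inf_{A\in\mathcal A,\;0<\pi(A)\le 1/2}\frac{\int_A K(x,A^c)\,\pi(dx)}{\pi(A)}\in[0,\infty]$$ be its conductance (with $\inf\emptyset=\infty$). Let $\nu$ be a probability measure on $\Omega$ that has a bounded density $\frac{d\nu}{d\pi}$ with respect to $\pi$, and let $X_1,X_2,\dots$ be a Markov chain with transition kernel $K$ and initial distribution $\nu$, i.e. $X_1\sim\nu$. For $f\in L_\infty(\Omega,\pi)$ real-valued and integers $n\ge1$, $n_0\ge0$ put $$S(f)=\int_\Omega f\,d\pi,\qquad S_{n,n_0}(f)=\frac1n\sum_{j=1}^n f(X_{n_0+j}),\qquad e(S_{n,n_0},f)=\bigl(\mathbf E\,|S_{n,n_0}(f)-S(f)|^2\bigr)^{1/2}.$$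 Then $$e(S_{n,n_0},f)\le \frac{2\sqrt{1+24\sqrt{\bigl\|\frac{d\nu}{d\pi}\bigr\|_\infty}\,\exp\bigl(-n_0\,\varphi^2/2\bigr)}}{\varphi\,\sqrt n}\,\|f\|_\infty ,$$ where $\|\cdot\|_\infty$ is the norm of $L_\infty(\Omega,\pi)$. If $\varphi=0$ the fraction is read as $+\infty$ (and $\infty\cdot 0=0$); if $\varphi=\infty$ it is read as $0$. -/

import Mathlib

open MeasureTheory ProbabilityTheory
open scoped ENNReal

namespace MCMC

/-- A Markov kernel `K` is lazy if it stays in the current state with probability at least `1/2`,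
that is `K(x, {x}) ≥ 1/2` for all `x`. -/
def IsLazy {E : Type*} [MeasurableSpace E] (K : Kernel E E) : Prop :=
  ∀ x : E, (1 / 2 : ℝ≥0∞) ≤ K x {x}

/-- The conductance `φ(K, π) = inf_{0 < π(A) ≤ 1/2} (∫_A K(x, Aᶜ) π(dx)) / π(A)`, the infimum being
over measurable sets. It takes values in `[0, ∞]`; it is `∞` exactly if no set is admissible. -/
noncomputable def conductance {E : Type*} [MeasurableSpace E] (K : Kernel E E) (π : Measure E) :
    ℝ≥0∞ :=
  ⨅ (A : Set E) (_ : MeasurableSet A) (_ : 0 < π A) (_ : π A ≤ 1 / 2),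
    (∫⁻ x in A, K x Aᶜ ∂π) / π A

/-- The `σ`-algebra `σ(X₁, …, X_k)`. -/
abbrev past {E S : Type*} [MeasurableSpace E] (X : ℕ → S → E) (k : ℕ) : MeasurableSpace S :=
  ⨆ i ∈ Finset.Icc 1 k, MeasurableSpace.comap (X i) inferInstance

/-- `X₁, X₂, …` is, under the probability `P`, a time-homogeneous Markov chain with transition
kernel `K` and initial distribution `ν`. The value `X 0` plays no role. The field `markov` says
that `P(X_{k+1} ∈ A | X₁, …, X_k) = K(X_k, A)` almost surely. -/
structure IsMarkovChain {E S : Type*} [MeasurableSpace E] [MeasurableSpace S]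
    (P : Measure S) (K : Kernel E E) (ν : Measure E) (X : ℕ → S → E) : Prop where
  measurable : ∀ i : ℕ, 1 ≤ i → Measurable (X i)
  initial : P.map (X 1) = ν
  markov : ∀ k : ℕ, 1 ≤ k → ∀ A : Set E, MeasurableSet A →
    ∀ B : Set S, MeasurableSet[past X k] B →
      P (B ∩ X (k + 1) ⁻¹' A) = ∫⁻ s in B, K (X k s) A ∂P

/-- The burn-in average `S_{n,n₀}(f) = (1/n) ∑_{j=1}^n f(X_{n₀+j})`. -/
noncomputable def burnInAverage {E S : Type*} (X : ℕ → S → E) (n n₀ : ℕ) (f : E → ℝ) (s : S) : ℝ :=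
  (1 / (n : ℝ)) * ∑ j ∈ Finset.Icc 1 n, f (X (n₀ + j) s)

/-- The error `e(S_{n,n₀}, f) = (𝐄 |S_{n,n₀}(f) - S(f)|²)^{1/2}`, where `S(f) = ∫ f dπ`. -/
noncomputable def meanSquareError {E S : Type*} [MeasurableSpace E] [MeasurableSpace S]
    (P : Measure S) (π : Measure E) (X : ℕ → S → E) (n n₀ : ℕ) (f : E → ℝ) : ℝ≥0∞ :=
  (∫⁻ s, ENNReal.ofReal (|burnInAverage X n n₀ f s - ∫ x, f x ∂π| ^ 2) ∂P) ^ (1 / 2 : ℝ)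

/-- The norm `‖dν/dπ‖_∞`, the `π`-essential supremum of the density. -/
noncomputable def densityNorm {E : Type*} [MeasurableSpace E] (ν π : Measure E) : ℝ≥0∞ :=
  essSup (ν.rnDeriv π) π

/-- The numerator `2 √(1 + 24 √‖dν/dπ‖_∞ exp(-n₀ φ² / 2))` of the error bound. Both `[0, ∞]`-valued
quantities are finite in all cases that matter: the density is assumed to be bounded, and if
`φ = ∞` then the error bound is `0` whatever finite value the numerator has. -/
noncomputable def boundNumerator {E : Type*} [MeasurableSpace E] (K : Kernel E E)
    (ν π : Measure E) (n₀ : ℕ) : ℝ :=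
  2 * Real.sqrt (1 + 24 * Real.sqrt (densityNorm ν π).toReal *
    Real.exp (-((n₀ : ℝ) * ((conductance K π).toReal ^ 2 / 2))))

end MCMC

/-!
The error bound comes from a spectral gap. A reversible kernel acts as a symmetric operator on
`L²(π)`, and laziness makes it positive semidefinite (`integral_mul_markovOp_nonneg`), so on the
functions of mean zero its norm is its numerical radius. Cheeger's inequality
(`integral_mul_markovOp_le`) bounds this radius by `β = 1 - φ² / 2`; it follows from the coarea
inequality `conductance_mul_lintegral_le` applied to the squares of the positive and negative parts
of `g - c`, where `c` is a median of `g`. Hence `‖K^k g‖₂ ≤ β ^ k ‖g‖₂` for `g` of mean zero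
(`integral_markovOp_iterate_sq_le`).

Let `g = f - S(f)`, `M = ‖f‖_∞`, and `h = dν/dπ`. By the Markov property and reversibility,
`𝐄 g(X_{1+m}) g(X_{1+m+k}) = ∫ (K^m h) g (K^k g) dπ`. Splitting `h = 1 + (h - 1)` gives the
stationary covariance, at most `β ^ k M²`, and a perturbation that the Cauchy–Schwarz inequality
bounds by
`‖K^m (h - 1)‖₂ ‖g‖_∞ ‖K^k g‖₂ ≤ β ^ m √‖h‖_∞ · 2 M · β ^ k M`
(`IsMarkovChain.integral_mul_le`). All times in the average have `m ≥ n₀`, and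
`β ^ n₀ ≤ exp (-n₀ φ² / 2)`. Each row of the matrix `β ^ |i - j|` sums to at most
`2 / (1 - β) = 4 / φ²`, so the mean square error is at most
`4 / (n φ²) · (1 + 2 √‖h‖_∞ exp (-n₀ φ² / 2)) M²`, which is stronger than the claim: the constant
`24` may be replaced by `2`.

The functions `f` and `h` are replaced by versions that are bounded everywhere, so that all
integrals converge. If `φ = ∞`, then `π` obeys a zero-one law, `f` is almost surely constant and the
error vanishes; if `φ = 0`, the bound is infinite unless `f` vanishes almost everywhere.
-/

namespace MCMC

/-! ### Bounded measurable functions -/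

/-- A real function that is measurable and bounded everywhere. All analysis below takes place in
this class; no `L²` quotient is needed. -/
structure BddMeas {E : Type*} [MeasurableSpace E] (g : E → ℝ) : Prop where
  measurable : Measurable g
  bdd : ∃ C, ∀ x, |g x| ≤ C

namespace BddMeas

variable {E F : Type*} [MeasurableSpace E] [MeasurableSpace F] {g h : E → ℝ}

lemma const (c : ℝ) : BddMeas (fun _ : E => c) := ⟨measurable_const, |c|, fun _ => le_rfl⟩

lemma add (hg : BddMeas g) (hh : BddMeas h) : BddMeas (fun x => g x + h x) := by
  obtain ⟨C, hC⟩ := hg.bdd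
  obtain ⟨D, hD⟩ := hh.bdd
  exact ⟨hg.measurable.add hh.measurable, C + D,
    fun x => (abs_add_le _ _).trans (add_le_add (hC x) (hD x))⟩

lemma mul (hg : BddMeas g) (hh : BddMeas h) : BddMeas (fun x => g x * h x) := by
  obtain ⟨C, hC⟩ := hg.bdd
  obtain ⟨D, hD⟩ := hh.bdd
  refine ⟨hg.measurable.mul hh.measurable, C * D, fun x => ?_⟩
  rw [abs_mul]
  exact mul_le_mul (hC x) (hD x) (abs_nonneg _) ((abs_nonneg _).trans (hC x))

lemma const_mul (c : ℝ) (hg : BddMeas g) : BddMeas (fun x => c * g x) := (const c).mul hg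

lemma sub (hg : BddMeas g) (hh : BddMeas h) : BddMeas (fun x => g x - h x) := by
  simpa [sub_eq_add_neg] using hg.add (hh.const_mul (-1))

lemma sq (hg : BddMeas g) : BddMeas (fun x => g x ^ 2) := by
  simpa [pow_two] using hg.mul hg

lemma max_zero (hg : BddMeas g) : BddMeas (fun x => max (g x) 0) := by
  obtain ⟨C, hC⟩ := hg.bdd
  refine ⟨hg.measurable.max measurable_const, C, fun x => ?_⟩
  rw [abs_of_nonneg (le_max_right _ _)]
  exact max_le ((le_abs_self _).trans (hC x)) ((abs_nonneg _).trans (hC x))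

lemma comp (hg : BddMeas g) {u : F → E} (hu : Measurable u) : BddMeas (fun x => g (u x)) := by
  obtain ⟨C, hC⟩ := hg.bdd
  exact ⟨hg.measurable.comp hu, C, fun x => hC _⟩

lemma sum {ι : Type*} (s : Finset ι) {G : ι → E → ℝ} (hG : ∀ i ∈ s, BddMeas (G i)) :
    BddMeas (fun x => ∑ i ∈ s, G i x) := by
  classical
  induction s using Finset.induction_on with
  | empty => simpa using const 0
  | insert a s ha ih =>
    simp only [Finset.sum_insert ha]
    exact (hG a (by simp)).add (ih fun i hi => hG i (by simp [hi]))

lemma integrable (hg : BddMeas g) (μ : Measure E) [IsFiniteMeasure μ] : Integrable g μ := by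
  obtain ⟨C, hC⟩ := hg.bdd
  exact Integrable.of_bound hg.measurable.aestronglyMeasurable C (.of_forall hC)

end BddMeas

/-- The Cauchy–Schwarz inequality for bounded functions. -/
lemma integral_mul_le_of_sq_le {E : Type*} [MeasurableSpace E] {μ : Measure E} [IsFiniteMeasure μ]
    {p q : E → ℝ} (hp : BddMeas p) (hq : BddMeas q) {A B : ℝ} (hA : 0 ≤ A) (hB : 0 ≤ B)
    (hpA : ∫ x, p x ^ 2 ∂μ ≤ A ^ 2) (hqB : ∫ x, q x ^ 2 ∂μ ≤ B ^ 2) :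
    ∫ x, p x * q x ∂μ ≤ A * B := by
  have key : (∫ x, p x * q x ∂μ) ^ 2 ≤ (∫ x, p x ^ 2 ∂μ) * ∫ x, q x ^ 2 ∂μ := by
    have h := discrim_le_zero (a := ∫ x, p x ^ 2 ∂μ) (b := 2 * ∫ x, p x * q x ∂μ)
      (c := ∫ x, q x ^ 2 ∂μ) (fun t => by
        have h0 : 0 ≤ ∫ x, (t * p x + q x) ^ 2 ∂μ := integral_nonneg fun x => sq_nonneg _
        have e : ∀ x, (t * p x + q x) ^ 2 = t * t * p x ^ 2 + 2 * t * (p x * q x) + q x ^ 2 :=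
          fun x => by ring
        simp only [e] at h0
        rw [integral_add (((hp.sq.const_mul _).add ((hp.mul hq).const_mul _)).integrable μ)
          (hq.sq.integrable μ), integral_add ((hp.sq.const_mul _).integrable μ)
          (((hp.mul hq).const_mul _).integrable μ), integral_const_mul, integral_const_mul] at h0
        linarith)
    rw [discrim] at h
    linarith
  refine le_of_abs_le (abs_le_of_sq_le_sq (key.trans ?_) (by positivity))
  rw [mul_pow]
  exact mul_le_mul hpA hqB (integral_nonneg fun x => sq_nonneg _) (sq_nonneg _)

/-! ### The Markov operator of a reversible kernel -/

/-- The Markov operator `(K g)(x) = ∫ g(y) K(x, dy)`. -/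
noncomputable def markovOp {E : Type*} [MeasurableSpace E] (K : Kernel E E) (g : E → ℝ) (x : E) :
    ℝ := ∫ y, g y ∂(K x)

lemma markovOp_const_mul {E : Type*} [MeasurableSpace E] (K : Kernel E E) (g : E → ℝ) (c : ℝ) :
    markovOp K (fun x => c * g x) = fun x => c * markovOp K g x := by
  funext x
  exact integral_const_mul _ _

section operator

variable {E : Type*} [MeasurableSpace E] {K : Kernel E E} [IsMarkovKernel K] {π : Measure E}
  [IsProbabilityMeasure π] {g h : E → ℝ}

lemma BddMeas.markovOp (hg : BddMeas g) : BddMeas (markovOp K g) := by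
  obtain ⟨C, hC⟩ := hg.bdd
  refine ⟨(hg.measurable.stronglyMeasurable.integral_kernel (κ := K)).measurable, C, fun x => ?_⟩
  simpa [MCMC.markovOp] using
    norm_integral_le_of_norm_le_const (μ := K x) (f := g) (C := C) (.of_forall hC)

lemma BddMeas.markovOp_iterate (hg : BddMeas g) (k : ℕ) :
    BddMeas ((MCMC.markovOp K)^[k] g) := by
  induction k generalizing g with
  | zero => exact hg
  | succ k ih => exact ih hg.markovOp

lemma markovOp_const (c : ℝ) : markovOp K (fun _ => c) = fun _ => c := by
  funext x
  simp [markovOp]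

lemma markovOp_sub (hg : BddMeas g) (hh : BddMeas h) :
    markovOp K (fun x => g x - h x) = fun x => markovOp K g x - markovOp K h x := by
  funext x
  exact integral_sub (hg.integrable _) (hh.integrable _)

lemma markovOp_iterate_sub_one (hg : BddMeas g) (k : ℕ) :
    (markovOp K)^[k] (fun x => g x - 1) = fun x => (markovOp K)^[k] g x - 1 := by
  induction k generalizing g with
  | zero => rfl
  | succ k ih =>
    simp only [Function.iterate_succ_apply]
    rw [markovOp_sub hg (.const 1), markovOp_const, ih hg.markovOp]

/-- Reversibility says that the law of two consecutive states of the stationary chain is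
symmetric. -/
lemma map_swap_compProd (hrev : K.IsReversible π) :
    (π ⊗ₘ K).map Prod.swap = π ⊗ₘ K := by
  have : IsProbabilityMeasure ((π ⊗ₘ K).map Prod.swap) :=
    Measure.isProbabilityMeasure_map (by fun_prop)
  refine Measure.ext_prod fun {s t} hs ht => ?_
  rw [Measure.map_apply measurable_swap (hs.prod ht), Set.preimage_swap_prod,
    Measure.compProd_apply_prod ht hs, Measure.compProd_apply_prod hs ht]
  exact hrev ht hs

lemma integral_compProd_swap (hrev : K.IsReversible π) {G : E × E → ℝ} (hG : Measurable G) :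
    ∫ z, G z.swap ∂(π ⊗ₘ K) = ∫ z, G z ∂(π ⊗ₘ K) := by
  conv_rhs => rw [← map_swap_compProd hrev]
  exact (integral_map (by fun_prop) hG.aestronglyMeasurable).symm

lemma integral_mul_markovOp (hg : BddMeas g) (hh : BddMeas h) :
    ∫ x, g x * markovOp K h x ∂π = ∫ z, g z.1 * h z.2 ∂(π ⊗ₘ K) := by
  rw [Measure.integral_compProd
    (((hg.comp measurable_fst).mul (hh.comp measurable_snd)).integrable _)]
  simp_rw [integral_const_mul]
  rfl

lemma integral_compProd_fst (hg : BddMeas g) :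
    ∫ z, g z.1 ∂(π ⊗ₘ K) = ∫ x, g x ∂π := by
  simpa [markovOp_const] using (integral_mul_markovOp (K := K) (π := π) hg (.const 1)).symm

lemma integral_compProd_snd (hrev : K.IsReversible π) (hg : BddMeas g) :
    ∫ z, g z.2 ∂(π ⊗ₘ K) = ∫ x, g x ∂π := by
  rw [← integral_compProd_fst (K := K) hg]
  exact integral_compProd_swap hrev (hg.measurable.comp measurable_fst)

lemma integral_mul_markovOp_comm (hrev : K.IsReversible π) (hg : BddMeas g) (hh : BddMeas h) :
    ∫ x, g x * markovOp K h x ∂π = ∫ x, markovOp K g x * h x ∂π := by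
  simp_rw [mul_comm (markovOp K g _)]
  rw [integral_mul_markovOp hg hh, integral_mul_markovOp hh hg, ← integral_compProd_swap hrev
    ((hg.comp measurable_fst).mul (hh.comp measurable_snd)).measurable]
  simp [mul_comm]

lemma integral_mul_markovOp_iterate_comm (hrev : K.IsReversible π) (hg : BddMeas g)
    (hh : BddMeas h) (k : ℕ) :
    ∫ x, g x * (markovOp K)^[k] h x ∂π = ∫ x, (markovOp K)^[k] g x * h x ∂π := by
  induction k generalizing g with
  | zero => rfl
  | succ k ih =>
    rw [Function.iterate_succ_apply', Function.iterate_succ_apply,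
      integral_mul_markovOp_comm hrev hg (hh.markovOp_iterate k), ih hg.markovOp]

lemma integral_markovOp (hrev : K.IsReversible π) (hg : BddMeas g) :
    ∫ x, markovOp K g x ∂π = ∫ x, g x ∂π := by
  simpa [markovOp_const] using integral_mul_markovOp_comm hrev (BddMeas.const (1 : ℝ)) hg

lemma integral_markovOp_iterate (hrev : K.IsReversible π) (hg : BddMeas g) (k : ℕ) :
    ∫ x, (markovOp K)^[k] g x ∂π = ∫ x, g x ∂π := by
  induction k generalizing g with
  | zero => rfl
  | succ k ih => rw [Function.iterate_succ_apply, ih hg.markovOp, integral_markovOp hrev hg]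

/-- The Dirichlet form `⟨g, (1 - K) g⟩` as the mean square of an increment. -/
lemma integral_sub_sq_compProd (hrev : K.IsReversible π) (hg : BddMeas g) :
    ∫ z, (g z.1 - g z.2) ^ 2 ∂(π ⊗ₘ K) =
      2 * (∫ x, g x ^ 2 ∂π - ∫ x, g x * markovOp K g x ∂π) := by
  have h1 := hg.comp (measurable_fst (α := E) (β := E))
  have h2 := hg.comp (measurable_snd (α := E) (β := E))
  have e : ∀ z : E × E, (g z.1 - g z.2) ^ 2 = g z.1 ^ 2 + g z.2 ^ 2 - 2 * (g z.1 * g z.2) :=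
    fun z => by ring
  simp_rw [e]
  rw [integral_sub ((h1.sq.add h2.sq).integrable _) (((h1.mul h2).const_mul 2).integrable _),
    integral_add (h1.sq.integrable _) (h2.sq.integrable _), integral_const_mul,
    integral_compProd_fst hg.sq, integral_compProd_snd hrev hg.sq, integral_mul_markovOp hg hg]
  ring

lemma integral_add_sq_compProd (hrev : K.IsReversible π) (hg : BddMeas g) :
    ∫ z, (g z.1 + g z.2) ^ 2 ∂(π ⊗ₘ K) =
      2 * (∫ x, g x ^ 2 ∂π + ∫ x, g x * markovOp K g x ∂π) := by
  have h1 := hg.comp (measurable_fst (α := E) (β := E))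
  have h2 := hg.comp (measurable_snd (α := E) (β := E))
  have e : ∀ z : E × E, (g z.1 + g z.2) ^ 2 = g z.1 ^ 2 + g z.2 ^ 2 + 2 * (g z.1 * g z.2) :=
    fun z => by ring
  simp_rw [e]
  rw [integral_add ((h1.sq.add h2.sq).integrable _) (((h1.mul h2).const_mul 2).integrable _),
    integral_add (h1.sq.integrable _) (h2.sq.integrable _), integral_const_mul,
    integral_compProd_fst hg.sq, integral_compProd_snd hrev hg.sq, integral_mul_markovOp hg hg]
  ring

/-- A lazy reversible Markov operator is positive semidefinite. The diagonal carries half of the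
mass of each `K(x, ·)`, so `∫ (g(x) + g(y))² K(x, dy) ≥ 2 g(x)²`. -/
lemma integral_mul_markovOp_nonneg (hlazy : IsLazy K) (hrev : K.IsReversible π)
    (hg : BddMeas g) : 0 ≤ ∫ x, g x * markovOp K g x ∂π := by
  have h1 := hg.comp (measurable_fst (α := E) (β := E))
  have h2 := hg.comp (measurable_snd (α := E) (β := E))
  have hpt : ∀ x, 2 * g x ^ 2 ≤ ∫ y, (g x + g y) ^ 2 ∂(K x) := by
    intro x
    have hx : BddMeas (fun y => (g x + g y) ^ 2) := ((BddMeas.const (g x)).add hg).sq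
    -- Markov's inequality replaces `{x}`, which need not be measurable, by a superlevel set.
    have hM := mul_meas_ge_le_integral_of_nonneg (μ := K x)
      (.of_forall fun y => sq_nonneg (g x + g y)) (hx.integrable _) (4 * g x ^ 2)
    have hhalf : (1 / 2 : ℝ) ≤ (K x).real {y | 4 * g x ^ 2 ≤ (g x + g y) ^ 2} := by
      have h : (1 / 2 : ℝ≥0∞) ≤ K x {y | 4 * g x ^ 2 ≤ (g x + g y) ^ 2} :=
        (hlazy x).trans (measure_mono (by
          intro y hy
          obtain rfl : y = x := hy
          simp only [Set.mem_ofPred_eq]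
          exact le_of_eq (by ring)))
      simpa [Measure.real] using ENNReal.toReal_mono (measure_ne_top _ _) h
    nlinarith [sq_nonneg (g x)]
  have hsum := integral_add_sq_compProd hrev hg
  rw [Measure.integral_compProd ((h1.add h2).sq.integrable _)] at hsum
  have hle : ∫ x, 2 * g x ^ 2 ∂π ≤ ∫ x, ∫ y, (g x + g y) ^ 2 ∂(K x) ∂π :=
    integral_mono ((hg.sq.const_mul 2).integrable _)
      (Integrable.integral_compProd ((h1.add h2).sq.integrable (π ⊗ₘ K))) hpt
  rw [integral_const_mul, hsum] at hle
  linarith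

end operator

/-! ### Cheeger's inequality and the spectral gap -/

/-- If the conductance is `∞`, its real value is `0`, so the bound needs no finiteness. -/
lemma conductance_toReal_le_one {E : Type*} [MeasurableSpace E] (K : Kernel E E)
    [IsMarkovKernel K] (π : Measure E) : (conductance K π).toReal ≤ 1 := by
  by_cases h : ∃ A, MeasurableSet A ∧ 0 < π A ∧ π A ≤ 1 / 2
  · obtain ⟨A, hA, h0, h2⟩ := h
    refine ENNReal.toReal_le_of_le_ofReal zero_le_one ?_
    rw [ENNReal.ofReal_one, conductance]
    refine iInf_le_of_le A (iInf_le_of_le hA (iInf_le_of_le h0 (iInf_le_of_le h2 ?_)))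
    refine ENNReal.div_le_of_le_mul ?_
    calc ∫⁻ x in A, K x Aᶜ ∂π ≤ ∫⁻ _ in A, 1 ∂π := lintegral_mono fun x => prob_le_one
      _ = 1 * π A := by simp
  · push Not at h
    have : conductance K π = ⊤ := by
      simp only [conductance, iInf_eq_top]
      intro A hA h0 h2
      exact absurd h2 (not_le.2 (h A hA h0))
    simp [this]

section cheeger

variable {E : Type*} [MeasurableSpace E] {K : Kernel E E} [IsMarkovKernel K] {π : Measure E}
  [IsProbabilityMeasure π] {g : E → ℝ}

lemma conductance_mul_le {A : Set E} (hA : MeasurableSet A) (hA2 : π A ≤ 1 / 2) :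
    conductance K π * π A ≤ (π ⊗ₘ K) (A ×ˢ Aᶜ) := by
  rcases eq_or_ne (π A) 0 with h0 | h0
  · simp [h0]
  rw [Measure.compProd_apply_prod hA hA.compl]
  refine ENNReal.mul_le_of_le_div ?_
  exact iInf_le_of_le A (iInf_le_of_le hA (iInf_le_of_le (pos_iff_ne_zero.2 h0)
    (iInf_le_of_le hA2 le_rfl)))

/-- The coarea inequality: the conductance bounds the flow out of each superlevel set of `v`, and
integration over the levels bounds the total positive decrement of `v` along a step. -/
lemma conductance_mul_lintegral_le {v : E → ℝ} (hv : Measurable v) (hv0 : ∀ x, 0 ≤ v x)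
    (hsupp : π {x | 0 < v x} ≤ 1 / 2) :
    conductance K π * ∫⁻ x, ENNReal.ofReal (v x) ∂π ≤
      ∫⁻ z, ENNReal.ofReal (v z.1 - v z.2) ∂(π ⊗ₘ K) := by
  let S : Set (ℝ × (E × E)) := {p | v p.2.2 ≤ p.1 ∧ p.1 < v p.2.1}
  have hS : MeasurableSet S :=
    (measurableSet_le (hv.comp (measurable_snd.comp measurable_snd)) measurable_fst).inter
      (measurableSet_lt measurable_fst (hv.comp (measurable_fst.comp measurable_snd)))
  have hanti : Antitone fun t => π {x | t < v x} := fun s t hst =>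
    measure_mono fun x (hx : t < v x) => lt_of_le_of_lt hst hx
  rw [lintegral_eq_lintegral_meas_lt π (.of_forall hv0) hv.aemeasurable,
    ← lintegral_const_mul _ hanti.measurable]
  calc ∫⁻ t in Set.Ioi 0, conductance K π * π {a | t < v a}
      ≤ ∫⁻ t in Set.Ioi 0, (π ⊗ₘ K) (Prod.mk t ⁻¹' S) := by
        refine setLIntegral_mono' measurableSet_Ioi fun t ht => ?_
        refine (conductance_mul_le (measurableSet_lt measurable_const hv)
          (le_trans (measure_mono fun x (hx : t < v x) => lt_trans ht hx) hsupp)).trans_eq ?_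
        congr 1
        ext z
        simp [S, and_comm]
    _ = ∫⁻ z, (volume.restrict (Set.Ioi 0)) ((fun t => (t, z)) ⁻¹' S) ∂(π ⊗ₘ K) := by
        rw [← Measure.prod_apply hS, Measure.prod_apply_symm hS]
    _ ≤ ∫⁻ z, ENNReal.ofReal (v z.1 - v z.2) ∂(π ⊗ₘ K) := by
        refine lintegral_mono fun z => ?_
        refine (Measure.restrict_le_self _).trans_eq ?_
        rw [← Real.volume_Ico]
        rfl

lemma conductance_mul_integral_le (hrev : K.IsReversible π) {v : E → ℝ} (hv : BddMeas v)
    (hv0 : ∀ x, 0 ≤ v x) (hsupp : π {x | 0 < v x} ≤ 1 / 2) :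
    2 * ((conductance K π).toReal * ∫ x, v x ∂π) ≤ ∫ z, |v z.1 - v z.2| ∂(π ⊗ₘ K) := by
  have h1 := hv.comp (measurable_fst (α := E) (β := E))
  have h2 := hv.comp (measurable_snd (α := E) (β := E))
  have hd := (h1.sub h2).max_zero
  have hd' := (h2.sub h1).max_zero
  have habs : ∫ z, |v z.1 - v z.2| ∂(π ⊗ₘ K) =
      2 * ∫ z, max (v z.1 - v z.2) 0 ∂(π ⊗ₘ K) := by
    have hsw : ∫ z, max (v z.2 - v z.1) 0 ∂(π ⊗ₘ K) = ∫ z, max (v z.1 - v z.2) 0 ∂(π ⊗ₘ K) :=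
      integral_compProd_swap hrev hd.measurable
    rw [two_mul]
    nth_rewrite 1 [← hsw]
    rw [← integral_add (hd'.integrable _) (hd.integrable _)]
    congr 1
    funext z
    rcases le_total (v z.1) (v z.2) with h | h
    · rw [abs_of_nonpos (by linarith), max_eq_left (by linarith), max_eq_right (by linarith)]
      ring
    · rw [abs_of_nonneg (by linarith), max_eq_right (by linarith), max_eq_left (by linarith)]
      ring
  have hle := conductance_mul_lintegral_le (K := K) hv.measurable hv0 hsupp
  rw [← ofReal_integral_eq_lintegral_ofReal (hv.integrable π) (.of_forall hv0)] at hle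
  have hR : ∫⁻ z, ENNReal.ofReal (v z.1 - v z.2) ∂(π ⊗ₘ K) =
      ENNReal.ofReal (∫ z, max (v z.1 - v z.2) 0 ∂(π ⊗ₘ K)) := by
    rw [ofReal_integral_eq_lintegral_ofReal (hd.integrable _)
      (.of_forall fun z => le_max_right _ _)]
    simp [ENNReal.ofReal_max]
  rw [hR] at hle
  have hR0 : 0 ≤ ∫ z, max (v z.1 - v z.2) 0 ∂(π ⊗ₘ K) :=
    integral_nonneg fun z => le_max_right _ _
  have := ENNReal.toReal_mono ENNReal.ofReal_ne_top hle
  rw [ENNReal.toReal_mul, ENNReal.toReal_ofReal (integral_nonneg hv0),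
    ENNReal.toReal_ofReal hR0] at this
  linarith

/-- The Cheeger inequality for functions supported on at most half of the space: apply the coarea
inequality to `u²`. -/
lemma conductance_sq_mul_le_of_support (hrev : K.IsReversible π) {u : E → ℝ} (hu : BddMeas u)
    (hu0 : ∀ x, 0 ≤ u x) (hsupp : π {x | 0 < u x} ≤ 1 / 2) :
    (conductance K π).toReal ^ 2 * ∫ x, u x ^ 2 ∂π ≤ ∫ z, (u z.1 - u z.2) ^ 2 ∂(π ⊗ₘ K) := by
  set φ := (conductance K π).toReal
  have hφ : 0 ≤ φ := ENNReal.toReal_nonneg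
  have h1 := hu.comp (measurable_fst (α := E) (β := E))
  have h2 := hu.comp (measurable_snd (α := E) (β := E))
  have hco := conductance_mul_integral_le hrev hu.sq (fun x => sq_nonneg _)
    (le_trans (measure_mono fun x (hx : 0 < u x ^ 2) => by
      have := hu0 x
      exact show 0 < u x from lt_of_le_of_ne this fun h => by simp [← h] at hx) hsupp)
  -- The weighted AM-GM inequality stands in for Cauchy–Schwarz and avoids square roots.
  have hpt : ∀ z : E × E, φ * |u z.1 ^ 2 - u z.2 ^ 2| ≤
      (u z.1 - u z.2) ^ 2 + φ ^ 2 / 2 * (u z.1 ^ 2 + u z.2 ^ 2) := by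
    intro z
    have e : |u z.1 ^ 2 - u z.2 ^ 2| = |u z.1 - u z.2| * (u z.1 + u z.2) := by
      rw [sq_sub_sq, abs_mul, abs_of_nonneg (add_nonneg (hu0 z.1) (hu0 z.2)), mul_comm]
    rw [e]
    nlinarith [sq_nonneg (|u z.1 - u z.2| - φ / 2 * (u z.1 + u z.2)), sq_abs (u z.1 - u z.2),
      mul_nonneg (sq_nonneg φ) (sq_nonneg (u z.1 - u z.2))]
  have hi : BddMeas fun z : E × E => |u z.1 ^ 2 - u z.2 ^ 2| := by
    obtain ⟨C, hC⟩ := (h1.sq.sub h2.sq).bdd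
    exact ⟨(h1.sq.sub h2.sq).measurable.abs, C, fun z => by rw [abs_abs]; exact hC z⟩
  have hmono := integral_mono (μ := π ⊗ₘ K) ((hi.const_mul φ).integrable _)
    (((h1.sub h2).sq.add ((h1.sq.add h2.sq).const_mul (φ ^ 2 / 2))).integrable _) hpt
  rw [integral_const_mul, integral_add ((h1.sub h2).sq.integrable _)
    (((h1.sq.add h2.sq).const_mul _).integrable _), integral_const_mul,
    integral_add (h1.sq.integrable _) (h2.sq.integrable _), integral_compProd_fst hu.sq,
    integral_compProd_snd hrev hu.sq] at hmono
  have := mul_le_mul_of_nonneg_left hco hφ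
  nlinarith

/-- A median: the infimum of the levels that `g` exceeds with probability at most `1 / 2`. -/
lemma exists_median (π : Measure E) [IsProbabilityMeasure π] (hg : BddMeas g) :
    ∃ c, π {x | c < g x} ≤ 1 / 2 ∧ π {x | g x < c} ≤ 1 / 2 := by
  obtain ⟨C, hC⟩ := hg.bdd
  let S : Set ℝ := {t | π {x | t < g x} ≤ 1 / 2}
  have hCS : C ∈ S := by
    have : {x | C < g x} = ∅ := by
      ext x
      simpa using (le_abs_self _).trans (hC x)
    simp [S, this]
  have hup : ∀ s ∈ S, ∀ t, s ≤ t → t ∈ S := fun s hs t hst =>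
    le_trans (measure_mono fun x (hx : t < g x) => lt_of_le_of_lt hst hx) hs
  have hbdd : BddBelow S := by
    refine ⟨-C, fun t ht => ?_⟩
    by_contra hlt
    have : {x | t < g x} = Set.univ := by
      ext x
      simpa using lt_of_lt_of_le (not_le.1 hlt) (neg_le_of_abs_le (hC x))
    simp only [S, Set.mem_ofPred_eq, this, measure_univ] at ht
    exact absurd ht (by norm_num)
  refine ⟨sInf S, ?_, ?_⟩
  · have e : {x | sInf S < g x} = ⋃ n : ℕ, {x | sInf S + 1 / ((n : ℝ) + 1) < g x} := by
      ext x
      simp only [Set.mem_ofPred_eq, Set.mem_iUnion]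
      constructor
      · intro h
        obtain ⟨n, hn⟩ := exists_nat_one_div_lt (sub_pos.2 h)
        exact ⟨n, by linarith⟩
      · rintro ⟨n, hn⟩
        have : (0 : ℝ) < 1 / ((n : ℝ) + 1) := by positivity
        linarith
    have hmono : Monotone fun n : ℕ => {x | sInf S + 1 / ((n : ℝ) + 1) < g x} := by
      intro m n hmn x hx
      have := Nat.one_div_le_one_div (α := ℝ) hmn
      simp only [Set.mem_ofPred_eq] at hx ⊢
      linarith
    rw [e, hmono.measure_iUnion]
    refine iSup_le fun n => ?_
    have hpos : (0 : ℝ) < 1 / ((n : ℝ) + 1) := by positivity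
    obtain ⟨s, hs, hlt⟩ := exists_lt_of_csInf_lt ⟨C, hCS⟩ (lt_add_of_pos_right (sInf S) hpos)
    exact hup s hs _ hlt.le
  · have e : {x | g x < sInf S} = ⋃ n : ℕ, {x | g x ≤ sInf S - 1 / ((n : ℝ) + 1)} := by
      ext x
      simp only [Set.mem_ofPred_eq, Set.mem_iUnion]
      constructor
      · intro h
        obtain ⟨n, hn⟩ := exists_nat_one_div_lt (sub_pos.2 h)
        exact ⟨n, by linarith⟩
      · rintro ⟨n, hn⟩
        have : (0 : ℝ) < 1 / ((n : ℝ) + 1) := by positivity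
        linarith
    have hmono : Monotone fun n : ℕ => {x | g x ≤ sInf S - 1 / ((n : ℝ) + 1)} := by
      intro m n hmn x hx
      have := Nat.one_div_le_one_div (α := ℝ) hmn
      simp only [Set.mem_ofPred_eq] at hx ⊢
      linarith
    rw [e, hmono.measure_iUnion]
    refine iSup_le fun n => ?_
    have hpos : (0 : ℝ) < 1 / ((n : ℝ) + 1) := by positivity
    have hn : sInf S - 1 / ((n : ℝ) + 1) ∉ S := fun h => by
      have := csInf_le hbdd h
      linarith
    have hc : {x | g x ≤ sInf S - 1 / ((n : ℝ) + 1)} =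
        {x | sInf S - 1 / ((n : ℝ) + 1) < g x}ᶜ := by
      ext x
      simp
    rw [hc, prob_compl_eq_one_sub (measurableSet_lt measurable_const hg.measurable),
      tsub_le_iff_right]
    have hh : 1 / 2 < π {x | sInf S - 1 / ((n : ℝ) + 1) < g x} := not_le.1 hn
    calc (1 : ℝ≥0∞) = 1 / 2 + 1 / 2 := (ENNReal.add_halves 1).symm
      _ ≤ _ := by gcongr

/-- The Cheeger inequality. The positive and negative parts of `g - c`, with `c` a median of `g`,
are each supported on at most half of the space. -/
lemma integral_mul_markovOp_le (hrev : K.IsReversible π) (hg : BddMeas g)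
    (hmean : ∫ x, g x ∂π = 0) :
    ∫ x, g x * markovOp K g x ∂π ≤
      (1 - (conductance K π).toReal ^ 2 / 2) * ∫ x, g x ^ 2 ∂π := by
  obtain ⟨c, hc1, hc2⟩ := exists_median π hg
  have hp : BddMeas fun x => max (g x - c) 0 := (hg.sub (.const c)).max_zero
  have hq : BddMeas fun x => max (c - g x) 0 := ((BddMeas.const c).sub hg).max_zero
  have hP := conductance_sq_mul_le_of_support hrev hp (fun x => le_max_right _ _)
    (by simpa using hc1)
  have hQ := conductance_sq_mul_le_of_support hrev hq (fun x => le_max_right _ _)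
    (by simpa using hc2)
  have hsq : ∫ x, max (g x - c) 0 ^ 2 ∂π + ∫ x, max (c - g x) 0 ^ 2 ∂π =
      ∫ x, g x ^ 2 ∂π + c ^ 2 := by
    rw [← integral_add (hp.sq.integrable π) (hq.sq.integrable π)]
    have e : ∀ x, max (g x - c) 0 ^ 2 + max (c - g x) 0 ^ 2 = g x ^ 2 - 2 * c * g x + c ^ 2 := by
      intro x
      rcases le_total (g x) c with h | h
      · rw [max_eq_right (by linarith), max_eq_left (by linarith)]
        ring
      · rw [max_eq_left (by linarith), max_eq_right (by linarith)]
        ring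
    simp_rw [e]
    rw [integral_add ((hg.sq.sub (hg.const_mul (2 * c))).integrable π) (integrable_const _),
      integral_sub (hg.sq.integrable π) ((hg.const_mul _).integrable π), integral_const_mul, hmean]
    simp
  have hcomp : ∀ {u : E → ℝ}, BddMeas u → Integrable (fun z : E × E => (u z.1 - u z.2) ^ 2)
      (π ⊗ₘ K) := fun hu => ((hu.comp measurable_fst).sub (hu.comp measurable_snd)).sq.integrable _
  have hinc := integral_mono (μ := π ⊗ₘ K) ((hcomp hp).add (hcomp hq)) (hcomp hg) (by
    intro z
    simp only [Pi.add_apply]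
    rcases le_total (g z.1) c with h | h <;> rcases le_total (g z.2) c with h' | h'
    · rw [max_eq_right (by linarith), max_eq_right (by linarith), max_eq_left (by linarith),
        max_eq_left (by linarith)]
      exact le_of_eq (by ring)
    · rw [max_eq_right (by linarith), max_eq_left (by linarith), max_eq_left (by linarith),
        max_eq_right (by linarith)]
      nlinarith
    · rw [max_eq_left (by linarith), max_eq_right (by linarith), max_eq_right (by linarith),
        max_eq_left (by linarith)]
      nlinarith
    · rw [max_eq_left (by linarith), max_eq_left (by linarith), max_eq_right (by linarith),
        max_eq_right (by linarith)]
      exact le_of_eq (by ring))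
  simp only [Pi.add_apply] at hinc
  rw [integral_add (hcomp hp) (hcomp hq), integral_sub_sq_compProd hrev hg] at hinc
  nlinarith [sq_nonneg ((conductance K π).toReal * c)]

/-- The operator norm of a positive semidefinite operator is its numerical radius, here on the
functions of mean zero. Positivity is applied to `β g - K g`. -/
lemma integral_markovOp_sq_le (hlazy : IsLazy K) (hrev : K.IsReversible π) (hg : BddMeas g)
    (hmean : ∫ x, g x ∂π = 0) :
    ∫ x, markovOp K g x ^ 2 ∂π ≤
      (1 - (conductance K π).toReal ^ 2 / 2) ^ 2 * ∫ x, g x ^ 2 ∂π := by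
  have hφ1 := conductance_toReal_le_one K π
  have hφ0 : 0 ≤ (conductance K π).toReal := ENNReal.toReal_nonneg
  have h1 := integral_mul_markovOp_le hrev hg hmean
  have h2 := integral_mul_markovOp_le hrev (hg.markovOp (K := K))
    ((integral_markovOp hrev hg).trans hmean)
  set β := 1 - (conductance K π).toReal ^ 2 / 2 with hβ
  have hβ0 : 0 < β := by nlinarith
  have hKg := hg.markovOp (K := K)
  have hKKg := hKg.markovOp (K := K)
  have h3 := integral_mul_markovOp_nonneg hlazy hrev ((hg.const_mul β).sub hKg)
  have hcross : ∫ x, g x * markovOp K (markovOp K g) x ∂π = ∫ x, markovOp K g x ^ 2 ∂π := by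
    rw [integral_mul_markovOp_comm hrev hg hKg]
    simp_rw [pow_two]
  have e : ∀ x, (β * g x - markovOp K g x) * markovOp K (fun x => β * g x - markovOp K g x) x =
      β ^ 2 * (g x * markovOp K g x) - β * (g x * markovOp K (markovOp K g) x)
        - β * markovOp K g x ^ 2 + markovOp K g x * markovOp K (markovOp K g) x := by
    intro x
    rw [markovOp_sub (hg.const_mul β) hKg, markovOp_const_mul]
    ring
  simp_rw [e] at h3
  have i1 := (hg.mul hKg).const_mul (β ^ 2)
  have i2 := (hg.mul hKKg).const_mul β
  have i3 := hKg.sq.const_mul β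
  rw [integral_add (((i1.sub i2).sub i3).integrable π) ((hKg.mul hKKg).integrable π),
    integral_sub ((i1.sub i2).integrable π) (i3.integrable π),
    integral_sub (i1.integrable π) (i2.integrable π), integral_const_mul, integral_const_mul,
    integral_const_mul, hcross] at h3
  have h4 : β * ∫ x, markovOp K g x ^ 2 ∂π ≤ β * (β ^ 2 * ∫ x, g x ^ 2 ∂π) := by
    nlinarith [mul_le_mul_of_nonneg_left h1 (sq_nonneg β)]
  exact le_of_mul_le_mul_left h4 hβ0

lemma integral_markovOp_iterate_sq_le (hlazy : IsLazy K) (hrev : K.IsReversible π)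
    (hg : BddMeas g) (hmean : ∫ x, g x ∂π = 0) (k : ℕ) :
    ∫ x, (markovOp K)^[k] g x ^ 2 ∂π ≤
      ((1 - (conductance K π).toReal ^ 2 / 2) ^ k) ^ 2 * ∫ x, g x ^ 2 ∂π := by
  induction k with
  | zero => simp
  | succ k ih =>
    rw [Function.iterate_succ_apply']
    refine (integral_markovOp_sq_le hlazy hrev (hg.markovOp_iterate k)
      ((integral_markovOp_iterate hrev hg k).trans hmean)).trans ?_
    refine (mul_le_mul_of_nonneg_left ih (sq_nonneg _)).trans_eq ?_
    ring

end cheeger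

/-! ### Covariances along the chain -/

lemma measurable_past {E S : Type*} [MeasurableSpace E] (X : ℕ → S → E) {i k : ℕ}
    (hi : 1 ≤ i) (hik : i ≤ k) :
    Measurable[past X k] (X i) :=
  measurable_iff_comap_le.2 (le_iSup₂_of_le i (Finset.mem_Icc.2 ⟨hi, hik⟩) le_rfl)

namespace IsMarkovChain

variable {E S : Type*} [MeasurableSpace E] [MeasurableSpace S] {P : Measure S}
  {K : Kernel E E} {π ν : Measure E} {X : ℕ → S → E}

lemma past_le (hX : IsMarkovChain P K ν X) (k : ℕ) : past X k ≤ ‹MeasurableSpace S› :=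
  iSup₂_le fun i hi => (hX.measurable i (Finset.mem_Icc.1 hi).1).comap_le

lemma map_absolutelyContinuous [IsMarkovKernel K] (hX : IsMarkovChain P K ν X)
    (hrev : K.IsReversible π) (hac : ν ≪ π) (m : ℕ) : P.map (X (1 + m)) ≪ π := by
  induction m with
  | zero => simpa [hX.initial] using hac
  | succ m ih =>
    have hm := hX.measurable (1 + m) (by omega)
    have hs := hX.measurable (1 + m + 1) (by omega)
    refine Measure.AbsolutelyContinuous.mk fun A hA h0 => ?_
    have hKA : (fun x => K x A) =ᵐ[π] 0 := by
      rw [← lintegral_eq_zero_iff (K.measurable_coe hA),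
        ← Measure.bind_apply hA K.aemeasurable, hrev.invariant]
      exact h0
    have hmk := hX.markov (1 + m) (by omega) A hA Set.univ .univ
    rw [Set.univ_inter, Measure.restrict_univ, ← lintegral_map (K.measurable_coe hA) hm,
      (lintegral_eq_zero_iff (K.measurable_coe hA)).2 (ih.ae_le hKA)] at hmk
    rw [← add_assoc, Measure.map_apply hs hA, hmk]

variable [IsProbabilityMeasure P] [IsMarkovKernel K] [IsProbabilityMeasure π]

/-- The Markov property for a bounded function of the next state and a bounded function of the
past. -/
lemma integral_mul_succ (hX : IsMarkovChain P K ν X) {k : ℕ} (hk : 1 ≤ k) {Z : S → ℝ}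
    (hZ : BddMeas Z) (hZp : Measurable[past X k] Z) {w : E → ℝ} (hw : BddMeas w) :
    ∫ s, Z s * w (X (k + 1) s) ∂P = ∫ s, Z s * markovOp K w (X k s) ∂P := by
  have hXk := hX.measurable k hk
  have hXs := hX.measurable (k + 1) (by omega)
  have hm := hX.past_le k
  have hmap : ∀ B, MeasurableSet[past X k] B →
      (P.restrict B).map (X (k + 1)) = K ∘ₘ (P.restrict B).map (X k) := by
    intro B hB
    ext A hA
    rw [Measure.map_apply hXs hA, Measure.restrict_apply (hXs hA),
      Measure.bind_apply hA K.aemeasurable, lintegral_map (K.measurable_coe hA) hXk,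
      ← hX.markov k hk A hA B hB, Set.inter_comm]
  have hce : (fun s => markovOp K w (X k s)) =ᵐ[P] P[fun s => w (X (k + 1) s) | past X k] := by
    refine ae_eq_condExp_of_forall_setIntegral_eq hm ((hw.comp hXs).integrable P)
      (fun B _ _ => ((hw.markovOp.comp hXk).integrable P).integrableOn) (fun B hB _ => ?_) ?_
    · have h1 : ∫ s in B, w (X (k + 1) s) ∂P = ∫ x, w x ∂((P.restrict B).map (X (k + 1))) :=
        (integral_map hXs.aemeasurable hw.measurable.aestronglyMeasurable).symm
      have h2 : ∫ s in B, markovOp K w (X k s) ∂P =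
          ∫ x, markovOp K w x ∂((P.restrict B).map (X k)) :=
        (integral_map hXk.aemeasurable hw.markovOp.measurable.aestronglyMeasurable).symm
      have h3 : ∫ x, w x ∂(((P.restrict B).map (X k)) ⊗ₘ K).snd =
          ∫ z, w z.2 ∂(((P.restrict B).map (X k)) ⊗ₘ K) :=
        integral_map measurable_snd.aemeasurable hw.measurable.aestronglyMeasurable
      rw [h1, h2, hmap B hB, ← Measure.snd_compProd, h3,
        Measure.integral_compProd ((hw.comp measurable_snd).integrable _)]
      rfl
    · exact (hw.markovOp.measurable.comp
        (measurable_past X hk le_rfl)).stronglyMeasurable.aestronglyMeasurable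
  have hpull := condExp_mul_of_stronglyMeasurable_left (μ := P) (m := past X k)
    (f := Z) (g := fun s => w (X (k + 1) s)) hZp.stronglyMeasurable
    ((hZ.mul (hw.comp hXs)).integrable P) ((hw.comp hXs).integrable P)
  calc ∫ s, Z s * w (X (k + 1) s) ∂P
      = ∫ s, (P[Z * (fun s => w (X (k + 1) s)) | past X k]) s ∂P := (integral_condExp hm).symm
    _ = ∫ s, Z s * markovOp K w (X k s) ∂P := by
      refine integral_congr_ae ?_
      filter_upwards [hpull, hce] with s h1 h2
      rw [h1, h2, Pi.mul_apply]

lemma integral_mul_add (hX : IsMarkovChain P K ν X) {i : ℕ} (hi : 1 ≤ i) {u w : E → ℝ}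
    (hu : BddMeas u) (hw : BddMeas w) (m : ℕ) :
    ∫ s, u (X i s) * w (X (i + m) s) ∂P =
      ∫ s, u (X i s) * (markovOp K)^[m] w (X i s) ∂P := by
  induction m generalizing w with
  | zero => rfl
  | succ m ih =>
    rw [Function.iterate_succ_apply, ← ih hw.markovOp]
    exact hX.integral_mul_succ (k := i + m) (by omega) (hu.comp (hX.measurable i hi))
      (hu.measurable.comp (measurable_past X hi (by omega))) hw

lemma integral_comp_add (hX : IsMarkovChain P K ν X) {w : E → ℝ} (hw : BddMeas w) (m : ℕ) :
    ∫ s, w (X (1 + m) s) ∂P = ∫ x, (markovOp K)^[m] w x ∂ν := by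
  have h := hX.integral_mul_add le_rfl (BddMeas.const (1 : ℝ)) hw m
  simp only [one_mul] at h
  rw [h, ← hX.initial]
  exact (integral_map (hX.measurable 1 le_rfl).aemeasurable
    (hw.markovOp_iterate m).measurable.aestronglyMeasurable).symm

/-- The covariance of two states of the chain, written with a bounded density `h` of the initial
distribution. Reversibility moves the transitions before time `1 + m` onto the density. -/
lemma integral_mul_eq (hX : IsMarkovChain P K ν X) (hrev : K.IsReversible π) {h : E → ℝ}
    (hh : BddMeas h) (hν : ∀ w : E → ℝ, BddMeas w → ∫ x, w x ∂ν = ∫ x, h x * w x ∂π)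
    {g : E → ℝ} (hg : BddMeas g) (m k : ℕ) :
    ∫ s, g (X (1 + m) s) * g (X (1 + m + k) s) ∂P =
      ∫ x, (markovOp K)^[m] h x * (g x * (markovOp K)^[k] g x) ∂π := by
  have hgk := hg.mul (hg.markovOp_iterate (K := K) k)
  rw [hX.integral_mul_add (by omega) hg hg k, hX.integral_comp_add hgk m,
    hν _ (hgk.markovOp_iterate m), integral_mul_markovOp_iterate_comm hrev hh hgk]

/-- The covariance of two states is the stationary one, bounded by the spectral gap, plus a
contribution of `h - 1`, which the transitions before time `1 + m` contract. -/
lemma integral_mul_le (hX : IsMarkovChain P K ν X) (hlazy : IsLazy K) (hrev : K.IsReversible π)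
    {h : E → ℝ} (hh : BddMeas h) (hh0 : ∀ x, 0 ≤ h x) (hh1 : ∫ x, h x ∂π = 1) {D : ℝ}
    (hhD : ∀ x, h x ≤ D)
    (hν : ∀ w : E → ℝ, BddMeas w → ∫ x, w x ∂ν = ∫ x, h x * w x ∂π)
    {g : E → ℝ} (hg : BddMeas g) (hmean : ∫ x, g x ∂π = 0) {M : ℝ} (hM : 0 ≤ M)
    (hgM : ∀ x, |g x| ≤ 2 * M) (hg2 : ∫ x, g x ^ 2 ∂π ≤ M ^ 2) (m k : ℕ) :
    ∫ s, g (X (1 + m) s) * g (X (1 + m + k) s) ∂P ≤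
      (1 - (conductance K π).toReal ^ 2 / 2) ^ k *
        ((1 + 2 * √D * (1 - (conductance K π).toReal ^ 2 / 2) ^ m) * M ^ 2) := by
  have hφ1 := conductance_toReal_le_one K π
  have hφ0 : 0 ≤ (conductance K π).toReal := ENNReal.toReal_nonneg
  have hcontr := fun (u : E → ℝ) (hu : BddMeas u) (h0 : ∫ x, u x ∂π = 0) (j : ℕ) =>
    integral_markovOp_iterate_sq_le hlazy hrev hu h0 j
  set β := 1 - (conductance K π).toReal ^ 2 / 2
  have hβ0 : 0 ≤ β := by
    have : (conductance K π).toReal ^ 2 ≤ 1 := pow_le_one₀ hφ0 hφ1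
    simp only [β]
    linarith
  have hD0 : 0 ≤ D := by
    obtain ⟨x⟩ := nonempty_of_isProbabilityMeasure π
    exact (hh0 x).trans (hhD x)
  have hgk := hg.markovOp_iterate (K := K) k
  have hh1' : BddMeas fun x => h x - 1 := hh.sub (.const 1)
  have hhm := hh1'.markovOp_iterate (K := K) m
  have hgk2 : ∫ x, (markovOp K)^[k] g x ^ 2 ∂π ≤ (β ^ k * M) ^ 2 := by
    rw [mul_pow]
    exact (hcontr g hg hmean k).trans (mul_le_mul_of_nonneg_left hg2 (sq_nonneg _))
  have hstat : ∫ x, g x * (markovOp K)^[k] g x ∂π ≤ M * (β ^ k * M) :=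
    integral_mul_le_of_sq_le hg hgk hM (by positivity) hg2 hgk2
  have hprod2 : ∫ x, (g x * (markovOp K)^[k] g x) ^ 2 ∂π ≤ (2 * M * (β ^ k * M)) ^ 2 := by
    calc ∫ x, (g x * (markovOp K)^[k] g x) ^ 2 ∂π
        ≤ ∫ x, (2 * M) ^ 2 * (markovOp K)^[k] g x ^ 2 ∂π := by
          refine integral_mono ((hg.mul hgk).sq.integrable π)
            ((hgk.sq.const_mul _).integrable π) fun x => ?_
          simp only [mul_pow (g x)]
          exact mul_le_mul_of_nonneg_right (sq_le_sq' (neg_le_of_abs_le (hgM x))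
            (le_of_abs_le (hgM x))) (sq_nonneg _)
      _ ≤ _ := by
          rw [integral_const_mul, mul_pow (2 * M)]
          exact mul_le_mul_of_nonneg_left hgk2 (sq_nonneg _)
  have hdens2 : ∫ x, (h x - 1) ^ 2 ∂π ≤ D := by
    have e : ∀ x, (h x - 1) ^ 2 = h x ^ 2 - 2 * h x + 1 := fun x => by ring
    have hle : ∫ x, h x ^ 2 ∂π ≤ D * 1 := by
      rw [← hh1, ← integral_const_mul]
      refine integral_mono (hh.sq.integrable π) ((hh.const_mul D).integrable π) fun x => ?_
      simp only [pow_two]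
      exact mul_le_mul_of_nonneg_right (hhD x) (hh0 x)
    simp_rw [e]
    rw [integral_add ((hh.sq.sub (hh.const_mul 2)).integrable π) (integrable_const _),
      integral_sub (hh.sq.integrable π) ((hh.const_mul 2).integrable π), integral_const_mul, hh1]
    simp
    linarith
  have hpert : ∫ x, (markovOp K)^[m] (fun x => h x - 1) x * (g x * (markovOp K)^[k] g x) ∂π ≤
      β ^ m * √D * (2 * M * (β ^ k * M)) := by
    refine integral_mul_le_of_sq_le hhm (hg.mul hgk) (by positivity) (by positivity) ?_ hprod2
    rw [mul_pow, Real.sq_sqrt hD0]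
    refine (hcontr _ hh1' ?_ m).trans (mul_le_mul_of_nonneg_left hdens2 (sq_nonneg _))
    rw [integral_sub (hh.integrable π) (integrable_const _), hh1]
    simp
  rw [hX.integral_mul_eq hrev hh hν hg m k]
  have e : ∀ x, (markovOp K)^[m] h x * (g x * (markovOp K)^[k] g x) =
      g x * (markovOp K)^[k] g x +
        (markovOp K)^[m] (fun x => h x - 1) x * (g x * (markovOp K)^[k] g x) := by
    intro x
    rw [markovOp_iterate_sub_one hh m]
    ring
  simp_rw [e]
  rw [integral_add ((hg.mul hgk).integrable π) ((hhm.mul (hg.mul hgk)).integrable π)]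
  calc _ ≤ M * (β ^ k * M) + β ^ m * √D * (2 * M * (β ^ k * M)) := add_le_add hstat hpert
    _ = _ := by ring

end IsMarkovChain

/-! ### Sums of covariances and the mean square error -/

section sums

variable {β : ℝ}

lemma geom_sum_le_one_div (h0 : 0 ≤ β) (h1 : β < 1) (m : ℕ) :
    ∑ k ∈ Finset.range m, β ^ k ≤ 1 / (1 - β) := by
  rw [le_div_iff₀ (by linarith), geom_sum_mul_neg]
  linarith [pow_nonneg h0 m]

lemma sum_range_pow_sub_le (h0 : 0 ≤ β) (h1 : β < 1) (i : ℕ) :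
    ∑ j ∈ Finset.range i, β ^ (i - j) ≤ 1 / (1 - β) := by
  refine le_trans ?_ (geom_sum_le_one_div h0 h1 (i + 1))
  rw [Finset.sum_range_succ', ← Finset.sum_range_reflect (fun k => β ^ (k + 1)) i]
  refine le_add_of_le_of_nonneg (Finset.sum_le_sum fun j hj => ?_) (by simp)
  rw [Finset.mem_range] at hj
  exact le_of_eq (congrArg (β ^ ·) (by omega))

/-- One row of the Toeplitz matrix `β ^ |i - j|`. The truncated differences `j - i` and `i - j` add
up to `|i - j|`. -/
lemma sum_pow_dist_le (h0 : 0 ≤ β) (h1 : β < 1) (i n : ℕ) :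
    ∑ j ∈ Finset.Icc 1 n, β ^ ((j - i) + (i - j)) ≤ 2 / (1 - β) := by
  have hsub : Finset.Icc 1 n ⊆ Finset.range i ∪ Finset.Ico i (n + 1) := by
    intro j hj
    simp only [Finset.mem_Icc, Finset.mem_union, Finset.mem_range, Finset.mem_Ico] at *
    omega
  have hdisj : Disjoint (Finset.range i) (Finset.Ico i (n + 1)) := by
    rw [Finset.disjoint_left]
    intro j hj hj'
    simp only [Finset.mem_range, Finset.mem_Ico] at *
    omega
  refine (Finset.sum_le_sum_of_subset_of_nonneg hsub fun j _ _ => pow_nonneg h0 _).trans ?_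
  rw [Finset.sum_union hdisj, show 2 / (1 - β) = 1 / (1 - β) + 1 / (1 - β) by ring]
  refine add_le_add ?_ ?_
  · refine (Finset.sum_le_sum fun j hj => ?_).trans (sum_range_pow_sub_le h0 h1 i)
    rw [Finset.mem_range] at hj
    exact le_of_eq (congrArg (β ^ ·) (by omega))
  · rw [Finset.sum_Ico_eq_sum_range]
    refine (Finset.sum_le_sum fun k _ => ?_).trans (geom_sum_le_one_div h0 h1 (n + 1 - i))
    exact le_of_eq (congrArg (β ^ ·) (by omega))

end sums

namespace IsMarkovChain

variable {E S : Type*} [MeasurableSpace E] [MeasurableSpace S] {P : Measure S}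
  {K : Kernel E E} {π ν : Measure E} {X : ℕ → S → E}

/-- The laws of all `X_i` with `i ≥ 1` are absolutely continuous with respect to `π`, so the error
depends only on the `π`-class of `f`. -/
lemma meanSquareError_congr [IsMarkovKernel K] (hX : IsMarkovChain P K ν X)
    (hrev : K.IsReversible π) (hac : ν ≪ π) {f f' : E → ℝ} (hff : f =ᵐ[π] f') (n n₀ : ℕ) :
    meanSquareError P π X n n₀ f = meanSquareError P π X n n₀ f' := by
  have hcomp : ∀ᵐ s ∂P, ∀ m, f (X (1 + m) s) = f' (X (1 + m) s) := by
    refine ae_all_iff.2 fun m => ?_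
    exact ae_of_ae_map (hX.measurable (1 + m) (by omega)).aemeasurable
      ((hX.map_absolutelyContinuous hrev hac m).ae_le hff)
  rw [meanSquareError, meanSquareError, integral_congr_ae hff]
  congr 1
  refine lintegral_congr_ae ?_
  filter_upwards [hcomp] with s hs
  have : burnInAverage X n n₀ f s = burnInAverage X n n₀ f' s := by
    rw [burnInAverage, burnInAverage]
    congr 1
    refine Finset.sum_congr rfl fun j hj => ?_
    rw [Finset.mem_Icc] at hj
    rw [show n₀ + j = 1 + (n₀ + j - 1) by omega]
    exact hs _
  rw [this]

lemma meanSquareError_eq_zero [IsMarkovKernel K] [IsProbabilityMeasure π]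
    (hX : IsMarkovChain P K ν X) (hrev : K.IsReversible π) (hac : ν ≪ π) {f : E → ℝ}
    {c : ℝ} (hf : f =ᵐ[π] fun _ => c) {n : ℕ} (hn : 1 ≤ n) (n₀ : ℕ) :
    meanSquareError P π X n n₀ f = 0 := by
  have hn' : (n : ℝ) ≠ 0 := by positivity
  rw [hX.meanSquareError_congr hrev hac hf]
  simp [meanSquareError, burnInAverage, hn']

lemma meanSquareError_le_ofReal [IsProbabilityMeasure P] (hX : IsMarkovChain P K ν X)
    {f : E → ℝ} (hf : BddMeas f)
    {n n₀ : ℕ} (hn : 1 ≤ n) {B : ℝ} (hB : 0 ≤ B)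
    (h : ∫ s, burnInAverage X n n₀ (fun x => f x - ∫ y, f y ∂π) s ^ 2 ∂P ≤ B ^ 2) :
    meanSquareError P π X n n₀ f ≤ ENNReal.ofReal B := by
  have hn' : (n : ℝ) ≠ 0 := by positivity
  have e : ∀ s, burnInAverage X n n₀ (fun x => f x - ∫ y, f y ∂π) s =
      burnInAverage X n n₀ f s - ∫ y, f y ∂π := by
    intro s
    simp only [burnInAverage, Finset.sum_sub_distrib]
    simp
    field_simp
  have hb : BddMeas fun s => burnInAverage X n n₀ f s - ∫ y, f y ∂π := by
    refine BddMeas.sub (BddMeas.const_mul _ (BddMeas.sum _ fun j hj => ?_)) (.const _)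
    rw [Finset.mem_Icc] at hj
    exact hf.comp (hX.measurable _ (by omega))
  simp_rw [e] at h
  simp_rw [meanSquareError, sq_abs]
  rw [← ofReal_integral_eq_lintegral_ofReal (hb.sq.integrable P)
    (.of_forall fun s => sq_nonneg _)]
  calc _ ≤ ENNReal.ofReal (B ^ 2) ^ (1 / 2 : ℝ) := by gcongr
    _ = ENNReal.ofReal B := by
      rw [ENNReal.ofReal_rpow_of_nonneg (sq_nonneg B) (by norm_num), ← Real.sqrt_eq_rpow,
        Real.sqrt_sq hB]

variable [IsProbabilityMeasure P] [IsMarkovKernel K] [IsProbabilityMeasure π]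

/-- The mean square of the burn-in average of a bounded function of mean zero. -/
lemma integral_burnInAverage_sq_le (hX : IsMarkovChain P K ν X) (hlazy : IsLazy K)
    (hrev : K.IsReversible π) (hφ : 0 < (conductance K π).toReal)
    {h : E → ℝ} (hh : BddMeas h) (hh0 : ∀ x, 0 ≤ h x) (hh1 : ∫ x, h x ∂π = 1) {D : ℝ}
    (hhD : ∀ x, h x ≤ D)
    (hν : ∀ w : E → ℝ, BddMeas w → ∫ x, w x ∂ν = ∫ x, h x * w x ∂π)
    {g : E → ℝ} (hg : BddMeas g) (hmean : ∫ x, g x ∂π = 0) {M : ℝ} (hM : 0 ≤ M)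
    (hgM : ∀ x, |g x| ≤ 2 * M) (hg2 : ∫ x, g x ^ 2 ∂π ≤ M ^ 2) (n n₀ : ℕ) :
    ∫ s, burnInAverage X n n₀ g s ^ 2 ∂P ≤ 4 / ((conductance K π).toReal ^ 2 * n) *
      ((1 + 2 * √D * Real.exp (-((n₀ : ℝ) * ((conductance K π).toReal ^ 2 / 2)))) * M ^ 2) := by
  have hφ1 := conductance_toReal_le_one K π
  have hpair := hX.integral_mul_le hlazy hrev hh hh0 hh1 hhD hν hg hmean hM hgM hg2
  set φ := (conductance K π).toReal
  set β := 1 - φ ^ 2 / 2 with hβ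
  have hφ2 : φ ^ 2 ≤ 1 := pow_le_one₀ hφ.le hφ1
  have hβ0 : 0 ≤ β := by linarith
  have hφsq : 0 < φ ^ 2 := by positivity
  have hβ1 : β < 1 := by linarith
  have hexp : ∀ m, n₀ ≤ m → β ^ m ≤ Real.exp (-((n₀ : ℝ) * (φ ^ 2 / 2))) := by
    intro m hm
    calc β ^ m ≤ β ^ n₀ := pow_le_pow_of_le_one hβ0 hβ1.le hm
      _ ≤ Real.exp (-(φ ^ 2 / 2)) ^ n₀ := by
        refine pow_le_pow_left₀ hβ0 ?_ n₀
        linarith [Real.add_one_le_exp (-(φ ^ 2 / 2))]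
      _ = _ := by
        rw [← Real.exp_nat_mul]
        ring_nf
  set C := (1 + 2 * √D * Real.exp (-((n₀ : ℝ) * (φ ^ 2 / 2)))) * M ^ 2
  have hC : 0 ≤ C := by positivity
  have hcov : ∀ i, 1 ≤ i → ∀ k, ∫ s, g (X (n₀ + i) s) * g (X (n₀ + i + k) s) ∂P ≤ β ^ k * C := by
    intro i hi k
    have := hpair (n₀ + (i - 1)) k
    rw [show 1 + (n₀ + (i - 1)) = n₀ + i by omega] at this
    refine this.trans (mul_le_mul_of_nonneg_left (mul_le_mul_of_nonneg_right ?_ (sq_nonneg M))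
      (pow_nonneg hβ0 k))
    have := mul_le_mul_of_nonneg_left (hexp (n₀ + (i - 1)) (by omega))
      (show 0 ≤ 2 * √D by positivity)
    linarith
  have hcov' : ∀ i ∈ Finset.Icc 1 n, ∀ j ∈ Finset.Icc 1 n,
      ∫ s, g (X (n₀ + i) s) * g (X (n₀ + j) s) ∂P ≤ β ^ ((j - i) + (i - j)) * C := by
    intro i hi j hj
    rw [Finset.mem_Icc] at hi hj
    rcases le_total i j with hij | hij
    · have := hcov i hi.1 (j - i)
      rwa [show n₀ + i + (j - i) = n₀ + j by omega,
        show j - i = (j - i) + (i - j) by omega] at this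
    · have := hcov j hj.1 (i - j)
      rw [show n₀ + j + (i - j) = n₀ + i by omega,
        show i - j = (j - i) + (i - j) by omega] at this
      simpa only [mul_comm (g (X (n₀ + i) _))] using this
  have hb : ∀ i ∈ Finset.Icc 1 n, ∀ j ∈ Finset.Icc 1 n,
      BddMeas fun s => g (X (n₀ + i) s) * g (X (n₀ + j) s) := by
    intro i hi j hj
    rw [Finset.mem_Icc] at hi hj
    exact (hg.comp (hX.measurable _ (by omega))).mul (hg.comp (hX.measurable _ (by omega)))
  have hexpand : ∫ s, burnInAverage X n n₀ g s ^ 2 ∂P = (1 / (n : ℝ)) ^ 2 *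
      ∑ i ∈ Finset.Icc 1 n, ∑ j ∈ Finset.Icc 1 n,
        ∫ s, g (X (n₀ + i) s) * g (X (n₀ + j) s) ∂P := by
    simp_rw [burnInAverage, mul_pow, pow_two (∑ j ∈ Finset.Icc 1 n, g (X (n₀ + j) _)),
      Finset.sum_mul_sum]
    rw [integral_const_mul, integral_finsetSum _ fun i hi =>
      (BddMeas.sum _ fun j hj => hb i hi j hj).integrable P]
    congr 1
    exact Finset.sum_congr rfl fun i hi =>
      integral_finsetSum _ fun j hj => (hb i hi j hj).integrable P
  rw [hexpand]
  have hsum : ∑ i ∈ Finset.Icc 1 n, ∑ j ∈ Finset.Icc 1 n,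
      ∫ s, g (X (n₀ + i) s) * g (X (n₀ + j) s) ∂P ≤ n * (2 / (1 - β) * C) := by
    calc _ ≤ ∑ i ∈ Finset.Icc 1 n, (2 / (1 - β) * C) := by
          refine Finset.sum_le_sum fun i hi => ?_
          refine (Finset.sum_le_sum fun j hj => hcov' i hi j hj).trans ?_
          rw [← Finset.sum_mul]
          exact mul_le_mul_of_nonneg_right (sum_pow_dist_le hβ0 hβ1 i n) hC
      _ = _ := by simp
  refine (mul_le_mul_of_nonneg_left hsum (sq_nonneg _)).trans_eq ?_
  rcases Nat.eq_zero_or_pos n with rfl | hn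
  · simp
  · have hn' : (n : ℝ) ≠ 0 := by positivity
    rw [show 1 - β = φ ^ 2 / 2 by rw [hβ]; ring]
    field_simp
    ring

end IsMarkovChain

/-! ### Degenerate conductance, bounded versions of `f` and `h`, and the error bound -/

section reductions

variable {E : Type*} [MeasurableSpace E] {K : Kernel E E} [IsMarkovKernel K] {π ν : Measure E}
  [IsProbabilityMeasure π]

/-- If no set is admissible in the definition of the conductance, then `π` obeys a zero-one law. -/
lemma ae_eq_const_of_conductance_eq_top (h : conductance K π = ⊤) {f : E → ℝ}
    (hf : Measurable f) : ∃ c, f =ᵐ[π] fun _ => c := by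
  have hadm : ∀ A, MeasurableSet A → π A ≤ 1 / 2 → π A = 0 := by
    intro A hA h2
    by_contra h0
    have := conductance_mul_le (K := K) hA h2
    rw [h, ENNReal.top_mul h0, top_le_iff] at this
    exact measure_ne_top _ _ this
  refine Filter.exists_eventuallyEq_const_of_forall_separating MeasurableSet fun U hU => ?_
  have hA := hf hU
  rcases le_total (π (f ⁻¹' U)) (1 / 2) with h2 | h2
  · exact Or.inr (measure_eq_zero_iff_ae_notMem.1 (hadm _ hA h2))
  · refine Or.inl (?_ : π (f ⁻¹' U)ᶜ = 0)
    refine hadm _ hA.compl ?_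
    rw [prob_compl_eq_one_sub hA, tsub_le_iff_right]
    calc (1 : ℝ≥0∞) = 1 / 2 + 1 / 2 := (ENNReal.add_halves 1).symm
      _ ≤ _ := by gcongr

/-- A version of an essentially bounded function, truncated at its `L_∞` norm. -/
lemma exists_bddMeas_ae_eq {E : Type*} [MeasurableSpace E] {π : Measure E} {f : E → ℝ}
    (hf : MemLp f ∞ π) :
    ∃ f', BddMeas f' ∧ f =ᵐ[π] f' ∧ ∀ x, |f' x| ≤ (eLpNorm f ∞ π).toReal := by
  set M := (eLpNorm f ∞ π).toReal
  have hM : 0 ≤ M := ENNReal.toReal_nonneg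
  have hbd : ∀ x, |max (-M) (min M (hf.1.mk f x))| ≤ M := fun x =>
    abs_le.2 ⟨le_max_left _ _, max_le (by linarith) (min_le_left _ _)⟩
  refine ⟨fun x => max (-M) (min M (hf.1.mk f x)),
    ⟨measurable_const.max (measurable_const.min hf.1.measurable_mk), M, hbd⟩, ?_, hbd⟩
  have hle := ae_le_eLpNormEssSup (f := f) (μ := π)
  filter_upwards [hf.1.ae_eq_mk, hle] with x hx hx2
  rw [← hx]
  rw [← eLpNorm_exponent_top] at hx2
  have : |f x| ≤ M := by
    have := ENNReal.toReal_mono hf.2.ne hx2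
    rwa [toReal_enorm, Real.norm_eq_abs] at this
  rw [min_eq_right (le_of_abs_le this), max_eq_right (neg_le_of_abs_le this)]

/-- A version of the density `dν/dπ` that is bounded everywhere. -/
lemma exists_bddMeas_density [IsProbabilityMeasure ν] (hac : ν ≪ π)
    (hbdd : densityNorm ν π < ∞) :
    ∃ h : E → ℝ, BddMeas h ∧ (∀ x, 0 ≤ h x) ∧ (∀ x, h x ≤ (densityNorm ν π).toReal) ∧
      ∀ w : E → ℝ, BddMeas w → ∫ x, w x ∂ν = ∫ x, h x * w x ∂π := by
  set D := (densityNorm ν π).toReal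
  have hD : 0 ≤ D := ENNReal.toReal_nonneg
  have hm : Measurable fun x => (ν.rnDeriv π x).toReal :=
    (Measure.measurable_rnDeriv ν π).ennreal_toReal
  have h0 : ∀ x, 0 ≤ min D (ν.rnDeriv π x).toReal := fun x => le_min hD ENNReal.toReal_nonneg
  refine ⟨fun x => min D (ν.rnDeriv π x).toReal,
    ⟨measurable_const.min hm, D, fun x => ?_⟩, h0, fun x => min_le_left _ _, fun w hw => ?_⟩
  · rw [abs_of_nonneg (h0 x)]
    exact min_le_left _ _
  · rw [← integral_rnDeriv_smul hac]
    refine integral_congr_ae ?_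
    filter_upwards [ENNReal.ae_le_essSup (μ := π) (ν.rnDeriv π)] with x hx
    rw [min_eq_right (ENNReal.toReal_mono hbdd.ne hx), smul_eq_mul]

end reductions

end MCMC

theorem mainTheorem1 {E S : Type*}
    [MeasurableSpace E] [MeasurableSpace.CountablyGenerated E] [MeasurableSpace S]
    (P : Measure S) [IsProbabilityMeasure P]
    (K : Kernel E E) [IsMarkovKernel K]
    (π ν : Measure E) [IsProbabilityMeasure π] [IsProbabilityMeasure ν]
    (hlazy : MCMC.IsLazy K) (hrev : K.IsReversible π)
    (hac : ν ≪ π) (hbdd : MCMC.densityNorm ν π < ∞)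
    (X : ℕ → S → E) (hX : MCMC.IsMarkovChain P K ν X)
    (f : E → ℝ) (hf : MemLp f ∞ π)
    (n n₀ : ℕ) (hn : 1 ≤ n) :
    MCMC.meanSquareError P π X n n₀ f ≤
      ENNReal.ofReal (MCMC.boundNumerator K ν π n₀) /
        (MCMC.conductance K π * ENNReal.ofReal (Real.sqrt n)) * eLpNorm f ∞ π := by
  obtain ⟨f', hf', hff, hfM⟩ := MCMC.exists_bddMeas_ae_eq hf
  obtain ⟨h, hh, hh0, hhD, hν⟩ := MCMC.exists_bddMeas_density hac hbdd
  have hh1 : ∫ x, h x ∂π = 1 := by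
    simpa using (hν _ (MCMC.BddMeas.const 1)).symm
  have hn0 : (0 : ℝ) < n := by exact_mod_cast hn
  set M := (eLpNorm f ∞ π).toReal with hMdef
  have hM : 0 ≤ M := ENNReal.toReal_nonneg
  have hfe : eLpNorm f ∞ π = ENNReal.ofReal M := (ENNReal.ofReal_toReal hf.2.ne).symm
  have hnum : 0 < MCMC.boundNumerator K ν π n₀ := by
    rw [MCMC.boundNumerator]
    positivity
  rcases eq_or_ne (MCMC.conductance K π) ⊤ with htop | htop
  · obtain ⟨c, hc⟩ := MCMC.ae_eq_const_of_conductance_eq_top htop hf'.measurable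
    rw [hX.meanSquareError_eq_zero hrev hac (hff.trans hc) hn]
    exact zero_le
  rcases hM.eq_or_lt with hM0 | hM0
  · have hc : f =ᵐ[π] fun _ => 0 := hff.trans (.of_forall fun x =>
      abs_nonpos_iff.1 ((hfM x).trans_eq hM0.symm))
    rw [hX.meanSquareError_eq_zero hrev hac hc hn]
    exact zero_le
  rcases eq_or_ne (MCMC.conductance K π) 0 with hz | hz
  · rw [hz, zero_mul, ENNReal.div_zero (ENNReal.ofReal_pos.2 hnum).ne', hfe,
      ENNReal.top_mul (ENNReal.ofReal_pos.2 hM0).ne']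
    exact le_top
  have hφ : 0 < (MCMC.conductance K π).toReal := ENNReal.toReal_pos hz htop
  have hR : ENNReal.ofReal (MCMC.boundNumerator K ν π n₀) /
        (MCMC.conductance K π * ENNReal.ofReal (Real.sqrt n)) * eLpNorm f ∞ π =
      ENNReal.ofReal (MCMC.boundNumerator K ν π n₀ /
        ((MCMC.conductance K π).toReal * √n) * M) := by
    rw [ENNReal.ofReal_mul (by positivity), ENNReal.ofReal_div_of_pos (by positivity),
      ENNReal.ofReal_mul hφ.le, ENNReal.ofReal_toReal htop, hfe]
  rw [hR, hX.meanSquareError_congr hrev hac hff]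
  refine hX.meanSquareError_le_ofReal hf' hn (by positivity) ?_
  have hg := hf'.sub (.const (∫ y, f' y ∂π))
  have hmean : ∫ x, (f' x - ∫ y, f' y ∂π) ∂π = 0 := by
    rw [integral_sub (hf'.integrable π) (integrable_const _)]
    simp
  have hS : |∫ y, f' y ∂π| ≤ M := by
    simpa using norm_integral_le_of_norm_le_const (μ := π) (f := f') (C := M) (.of_forall hfM)
  have hgM : ∀ x, |f' x - ∫ y, f' y ∂π| ≤ 2 * M := fun x =>
    (abs_sub _ _).trans (by linarith [hfM x])
  have hg2 : ∫ x, (f' x - ∫ y, f' y ∂π) ^ 2 ∂π ≤ M ^ 2 := by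
    have e : ∀ x, (f' x - ∫ y, f' y ∂π) ^ 2 =
        f' x ^ 2 - 2 * (∫ y, f' y ∂π) * f' x + (∫ y, f' y ∂π) ^ 2 := fun x => by ring
    have hle : ∫ x, f' x ^ 2 ∂π ≤ ∫ _, M ^ 2 ∂π :=
      integral_mono (hf'.sq.integrable π) (integrable_const _) fun x =>
        sq_le_sq' (neg_le_of_abs_le (hfM x)) (le_of_abs_le (hfM x))
    simp_rw [e]
    rw [integral_add ((hf'.sq.sub (hf'.const_mul _)).integrable π) (integrable_const _),
      integral_sub (hf'.sq.integrable π) ((hf'.const_mul _).integrable π), integral_const_mul]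
    simp at hle ⊢
    nlinarith [sq_nonneg (∫ y, f' y ∂π)]
  refine (hX.integral_burnInAverage_sq_le hlazy hrev hφ hh hh0 hh1 hhD hν hg hmean hM hgM hg2
    n n₀).trans ?_
  rw [mul_pow, div_pow, mul_pow, MCMC.boundNumerator, mul_pow, Real.sq_sqrt (by positivity),
    Real.sq_sqrt hn0.le, ← mul_assoc, mul_div_right_comm (2 ^ 2 : ℝ)]
  refine mul_le_mul_of_nonneg_right ?_ (sq_nonneg M)
  rw [show (2 : ℝ) ^ 2 = 4 by norm_num]
  refine mul_le_mul_of_nonneg_left ?_ (by positivity)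
  have : 0 ≤ √(MCMC.densityNorm ν π).toReal *
      Real.exp (-((n₀ : ℝ) * ((MCMC.conductance K π).toReal ^ 2 / 2))) := by positivity
  linarith
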